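/- Let $n\ge 10$ and let $A_n$ be the alternating group on $[n]=\{1,\dots,n\}$. Let $A_n$ act by affine maps on $\mathbb{R}^m$ and on $\mathbb{R}^d$, and let $P\subseteq\mathbb{R}^m$ and $Q\subseteq\mathbb{R}^d$ be polytopes (convex hulls of finite sets) with $gP=P$ and $gQ=Q$ for all $g\in A_n$. Suppose that $Q$ is a symmetric extension of $P$, i.e. there is a linear map $p\colon\mathbb{R}^d\to\mathbb{R}^m$ with $p(Q)=P$ and $p(gx)=g\,p(x)$ for all $g\in A_n$ and $x\in Q$. A facet of $Q$ is a nonempty face of $Q$ of dimension $\dim Q-1$; the group $A_n$ acts on the set of facets by $j\mapsto gj=\{gx : x\in j\}$. Assume that the number $N$ of facets of $Q$ satisfies $N<n(n-1)/2$. Then for every facet $j$ of $Q$ the orbit $A_n j$ is isomorphic, as a set with an action of $A_n$, either to $[n]$ with the natural action of $A_n$ or to a one-point set (i.e. $j$ is fixed by $A_n$). In particular, the orbits of $A_n$ partition the set of the $N$ facets of $Q$ into sets of sizes $n$ and $1$. -/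

import Mathlib

open scoped Pointwise

/-- A polytope: the convex hull of a finite set of points. -/
def IsPolytope {E : Type*} [AddCommGroup E] [Module ℝ E] (P : Set E) : Prop :=
  ∃ s : Set E, s.Finite ∧ P = convexHull ℝ s

/-- The action of `G` on the real vector space `E` is affine: every group element acts as an
affine map. -/
def IsAffineAction (G E : Type*) [Group G] [AddCommGroup E] [Module ℝ E] [MulAction G E] : Prop :=
  ∀ g : G, ∃ A : E →ᵃ[ℝ] E, ∀ x : E, g • x = A x

/-- `P` is a `G`-polytope: a polytope in a space with an affine action of `G` that leaves
`P` invariant. -/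
structure IsGPolytope (G : Type*) {E : Type*} [Group G] [AddCommGroup E] [Module ℝ E]
    [MulAction G E] (P : Set E) : Prop where
  isPolytope : IsPolytope P
  isAffineAction : IsAffineAction G E
  smul_eq : ∀ g : G, g • P = P

/-- `Q` together with the linear map `p` is an extension of `P`. -/
structure IsExtension {E F : Type*} [AddCommGroup E] [Module ℝ E] [AddCommGroup F] [Module ℝ F]
    (Q : Set F) (p : F →ₗ[ℝ] E) (P : Set E) : Prop where
  isPolytope : IsPolytope Q
  image_eq : p '' Q = P

/-- `Q` together with the linear map `p` is a symmetric extension of the `G`-polytope `P`. -/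
structure IsSymmetricExtension (G : Type*) {E F : Type*} [Group G]
    [AddCommGroup E] [Module ℝ E] [MulAction G E] [AddCommGroup F] [Module ℝ F] [MulAction G F]
    (Q : Set F) (p : F →ₗ[ℝ] E) (P : Set E) : Prop where
  isExtension : IsExtension Q p P
  isGPolytope : IsGPolytope G Q
  map_smul : ∀ g : G, ∀ x ∈ Q, p (g • x) = g • p x

/-- The facets of a polytope `Q`: the nonempty faces (sets of maximizers over `Q` of a linear
functional) whose affine dimension is one less than that of `Q`. -/
def facets {E : Type*} [AddCommGroup E] [Module ℝ E] [TopologicalSpace E] (Q : Set E) :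
    Set (Set E) :=
  {F | F.Nonempty ∧ IsExposed ℝ Q F ∧
    Module.finrank ℝ (vectorSpan ℝ F) + 1 = Module.finrank ℝ (vectorSpan ℝ Q)}

/-- Two sets with an action of `G` are isomorphic: there is a `G`-equivariant bijection. -/
def IsoActions (G X Y : Type*) [Group G] [MulAction G X] [MulAction G Y] : Prop :=
  ∃ f : X →[G] Y, Function.Bijective f

/-!
The affine action permutes the facets of `Q`, so the orbit of a facet has fewer than `n.choose 2`
elements and its stabilizer `H ≤ Aₙ` has index below `n.choose 2`. The theorem therefore reduces to
a statement about groups, `eq_top_or_eq_stabilizer_of_index_lt`: for `n ≥ 10` such an `H` is `Aₙ` or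
the stabilizer of a point of `[n]`. An orbit is determined up to isomorphism by a point stabilizer.

For the group theory, Bochert's argument (`exists_threeCycle_mem`) first gives a 3-cycle in `H`.
Take a largest set `Γ` such that `H` meets `Alt(Γ)` trivially. The elements of `Alt(Γ)` lie in
distinct cosets of `H`, so `|Γ|! / 2` is at most the index, whence `|Γ| < n / 2`. Then the complement
of `Γ` is larger than `Γ`, so some `x ≠ 1` in `H` is supported off `Γ`. If `x` moves `p`, some `y ≠ 1`
in `H` is supported in `Γ ∪ {p}`, and the commutator of `x` and `y` is a 3-cycle.

Now let `s` be a largest set with `Alt(s) ≤ H`. By maximality `s` is a block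
(`ContainsAlt.image_eq_of_maximal`): each translate of `s` under `H` is `s` or disjoint from it.
* If `|s| ≥ n - 1`, then `H` contains a point stabilizer, a maximal subgroup.
* If `n / 2 < |s| ≤ n - 2`, then `H` preserves `s`, and its index is at least
  `n.choose |s| ≥ n.choose 2`.
* If `|s| ≤ n / 2`, then the stabilizer in `H` of a point `p ∈ s` preserves `s`, and counting the
  translates of `s` through `p` shows that the index is at least `(n - 1).choose (|s| - 1)`. This
  suffices for `|s| ≥ 4`. For `|s| = 3` the estimate is doubled by an element of
  `Alt(sᶜ)` outside `H`, which exists since `|sᶜ| > |s|`.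
-/

/-! ### Three-cycles and alternating subgroups -/

section ThreeCycles

open Equiv Equiv.Perm

variable {α : Type*} [DecidableEq α]

/-- The permutation `a ↦ b ↦ c ↦ a`; it is a 3-cycle when `a`, `b`, `c` are distinct. -/
def threeCycle (a b c : α) : Perm α := swap a b * swap b c

theorem conj_threeCycle (g : Perm α) (a b c : α) :
    g * threeCycle a b c * g⁻¹ = threeCycle (g a) (g b) (g c) := by
  rw [mul_inv_eq_iff_eq_mul, threeCycle, threeCycle, ← mul_assoc, mul_swap_eq_swap_mul g,
    mul_assoc, mul_swap_eq_swap_mul g, mul_assoc]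

theorem threeCycle_rotate {a b c : α} (hab : a ≠ b) (hac : a ≠ c) (hbc : b ≠ c) :
    threeCycle a b c = threeCycle b c a := by
  ext x
  simp only [threeCycle, Perm.mul_apply, swap_apply_def]
  grind

theorem threeCycle_inv (a b c : α) : (threeCycle a b c)⁻¹ = threeCycle c b a := by
  simp [threeCycle, swap_comm]

theorem threeCycle_apply_left {a b c : α} (hab : a ≠ b) (hac : a ≠ c) :
    threeCycle a b c a = b := by
  simp [threeCycle, swap_apply_of_ne_of_ne hab hac]

theorem threeCycle_apply_middle {a b c : α} (hac : a ≠ c) (hbc : b ≠ c) :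
    threeCycle a b c b = c := by
  simp [threeCycle, swap_apply_of_ne_of_ne hac.symm hbc.symm]

theorem threeCycle_apply_right (a b c : α) : threeCycle a b c c = a := by
  simp [threeCycle]

theorem threeCycle_apply_of_ne {a b c x : α} (ha : x ≠ a) (hb : x ≠ b) (hc : x ≠ c) :
    threeCycle a b c x = x := by
  simp [threeCycle, swap_apply_of_ne_of_ne, ha, hb, hc]

theorem threeCycle_mem_alternatingGroup [Fintype α] {a b c : α} (hab : a ≠ b) (hbc : b ≠ c) :
    threeCycle a b c ∈ alternatingGroup α := by
  simp [threeCycle, mem_alternatingGroup, sign_swap hab, sign_swap hbc]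

/-- Two permutations whose supports meet in a single point have a 3-cycle as commutator. -/
theorem commutator_eq_threeCycle {x y : Perm α} {p : α} (hx : x p ≠ p) (hy : y p ≠ p)
    (hxy : ∀ q, q ≠ p → x q = q ∨ y q = q) :
    x * y * x⁻¹ * y⁻¹ = threeCycle (y p) p (x p) := by
  have hxy' : x p ≠ y p := by
    intro h
    rcases hxy (x p) hx with h1 | h1
    · exact hx (x.injective h1)
    · rw [h] at h1; exact hy (y.injective h1)
  have hyxp : y (x p) = x p := (hxy (x p) hx).resolve_left fun h => hx (x.injective h)
  have hxyp : x (y p) = y p := (hxy (y p) hy).resolve_right fun h => hy (y.injective h)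
  rw [mul_inv_eq_iff_eq_mul, mul_inv_eq_iff_eq_mul]
  ext q
  simp only [Perm.mul_apply]
  by_cases hq : q = p
  · subst hq
    rw [hxyp, hyxp, threeCycle_apply_right]
  by_cases hq1 : y q = p
  · have hxq : x q = q := by
      refine (hxy q hq).resolve_right fun h => hq ?_
      rw [← h, hq1]
    rw [hq1, hxq, hq1, threeCycle_apply_middle hxy'.symm hx.symm]
  by_cases hq2 : x q = p
  · have hyq : y q = q := by
      refine (hxy q hq).resolve_left fun h => hq ?_
      rw [← h, hq2]
    rw [hyq, hq2, threeCycle_apply_left hy hxy'.symm]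
  have h1 : y q ≠ y p := fun h => hq (y.injective h)
  have h2 : x q ≠ x p := fun h => hq (x.injective h)
  rcases hxy q hq with h | h
  · rw [h, threeCycle_apply_of_ne h1 hq1]
    · exact (hxy _ hq1).elim id fun h' => by rw [y.injective h', h]
    · intro h'
      rw [← hyxp] at h'
      exact h2 (h.trans (y.injective h'))
  · have h3 : y (x q) = x q :=
      (hxy _ hq2).elim (fun h' => by rw [x.injective h', h]) id
    rw [h, h3, threeCycle_apply_of_ne _ hq2 h2]
    intro h'
    rw [← hxyp] at h'
    exact h1 (h.trans (x.injective h'))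

/-- `ContainsAlt K s` says that `K` contains the alternating group on `s`, expressed through the
3-cycles that generate it. -/
def ContainsAlt (K : Subgroup (Perm α)) (s : Finset α) : Prop :=
  ∀ a ∈ s, ∀ b ∈ s, ∀ c ∈ s, a ≠ b → a ≠ c → b ≠ c → threeCycle a b c ∈ K

variable {K : Subgroup (Perm α)} {s t : Finset α}

theorem ContainsAlt.image (hs : ContainsAlt K s) {g : Perm α} (hg : g ∈ K) :
    ContainsAlt K (s.image g) := by
  intro a ha b hb c hc hab hac hbc
  obtain ⟨a', ha', rfl⟩ := Finset.mem_image.1 ha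
  obtain ⟨b', hb', rfl⟩ := Finset.mem_image.1 hb
  obtain ⟨c', hc', rfl⟩ := Finset.mem_image.1 hc
  rw [← conj_threeCycle]
  exact K.mul_mem (K.mul_mem hg (hs a' ha' b' hb' c' hc' (fun h => hab (h ▸ rfl))
    (fun h => hac (h ▸ rfl)) fun h => hbc (h ▸ rfl))) (K.inv_mem hg)

theorem containsAlt_triple {a b c : α} (hab : a ≠ b) (hac : a ≠ c) (hbc : b ≠ c)
    (h : threeCycle a b c ∈ K) : ContainsAlt K {a, b, c} := by
  have h1 := threeCycle_rotate hab hac hbc ▸ h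
  have h2 := threeCycle_rotate hbc hab.symm hac.symm ▸ h1
  have h' := K.inv_mem h
  have h1' := K.inv_mem h1
  have h2' := K.inv_mem h2
  rw [threeCycle_inv] at h' h1' h2'
  intro x hx y hy z hz hxy hxz hyz
  simp only [Finset.mem_insert, Finset.mem_singleton] at hx hy hz
  rcases hx with rfl | rfl | rfl <;> rcases hy with rfl | rfl | rfl <;>
    rcases hz with rfl | rfl | rfl <;> first | contradiction | assumption

/-- A single 3-cycle through two points of `s` and a new point `t` suffices to enlarge `s` by
`t`. -/
theorem ContainsAlt.insert_of_threeCycle (hs : ContainsAlt K s) {p q t : α} (ht : t ∉ s)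
    (hp : p ∈ s) (hq : q ∈ s) (hpq : p ≠ q) (h : threeCycle p q t ∈ K) :
    ContainsAlt K (insert t s) := by
  have ne : ∀ {x}, x ∈ s → x ≠ t := fun hx h => ht (h ▸ hx)
  -- the relation `threeCycle a b t ∈ K` on distinct points of `s` is symmetric ...
  have symm : ∀ a ∈ s, ∀ b ∈ s, a ≠ b → threeCycle a b t ∈ K → threeCycle b a t ∈ K := by
    intro a ha b hb hab h
    have := K.inv_mem h
    rwa [threeCycle_inv, threeCycle_rotate (ne hb).symm (ne ha).symm hab.symm] at this
  -- ... and an edge reaches every further point of `s`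
  have step : ∀ a ∈ s, ∀ b ∈ s, a ≠ b → threeCycle a b t ∈ K →
      ∀ c ∈ s, a ≠ c → threeCycle a c t ∈ K := by
    intro a ha b hb hab h c hc hac
    by_cases hbc : b = c
    · exact hbc ▸ h
    have hg := hs b hb a ha c hc (Ne.symm hab) hbc hac
    have := K.mul_mem (K.mul_mem hg h) (K.inv_mem hg)
    rw [conj_threeCycle, threeCycle_apply_middle hbc hac,
      threeCycle_apply_left (Ne.symm hab) hbc,
      threeCycle_apply_of_ne (ne hb).symm (ne ha).symm (ne hc).symm] at this
    exact symm c hc a ha hac.symm this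
  have all : ∀ a ∈ s, ∀ b ∈ s, a ≠ b → threeCycle a b t ∈ K := by
    intro a ha b hb hab
    by_cases hpa : p = a
    · subst hpa
      exact step p hp q hq hpq h b hb hab
    · exact step a ha p hp (Ne.symm hpa) (symm p hp a ha hpa (step p hp q hq hpq h a ha hpa))
        b hb hab
  intro a ha b hb c hc hab hac hbc
  rcases Finset.mem_insert.1 ha with rfl | has
  · have hb := (Finset.mem_insert.1 hb).resolve_left hab.symm
    have hc := (Finset.mem_insert.1 hc).resolve_left hac.symm
    rw [threeCycle_rotate hab hac hbc]
    exact all b hb c hc hbc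
  rcases Finset.mem_insert.1 hb with rfl | hbs
  · have hc := (Finset.mem_insert.1 hc).resolve_left hbc.symm
    rw [← threeCycle_rotate hac.symm hbc.symm hab]
    exact all c hc a has hac.symm
  rcases Finset.mem_insert.1 hc with rfl | hcs
  · exact all a has b hbs hab
  · exact hs a has b hbs c hcs hab hac hbc

theorem ContainsAlt.insert_of_mem_inter (hs : ContainsAlt K s) (ht : ContainsAlt K t)
    (hs3 : 3 ≤ s.card) (ht3 : 3 ≤ t.card) {p r : α} (hps : p ∈ s) (hpt : p ∈ t)
    (hrt : r ∈ t) (hrs : r ∉ s) : ContainsAlt K (insert r s) := by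
  have hpr : p ≠ r := fun h => hrs (h ▸ hps)
  obtain ⟨u, hut, hu⟩ : ∃ u ∈ t, u ∉ ({p, r} : Finset α) :=
    Finset.exists_mem_notMem_of_card_lt_card (Finset.card_le_two.trans_lt ht3)
  simp only [Finset.mem_insert, Finset.mem_singleton, not_or] at hu
  by_cases hus : u ∈ s
  · exact hs.insert_of_threeCycle hrs hps hus (Ne.symm hu.1)
      (ht p hpt u hut r hrt (Ne.symm hu.1) hpr hu.2)
  · obtain ⟨a, ha, hap⟩ := Finset.exists_mem_ne (by omega : 1 < s.card) p
    obtain ⟨b, hb, hbn⟩ : ∃ b ∈ s, b ∉ ({p, a} : Finset α) :=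
      Finset.exists_mem_notMem_of_card_lt_card (Finset.card_le_two.trans_lt hs3)
    simp only [Finset.mem_insert, Finset.mem_singleton, not_or] at hbn
    have ne : ∀ {x y}, x ∈ s → y ∉ s → x ≠ y := fun hx hy h => hy (h ▸ hx)
    have hg := ht p hpt r hrt u hut hpr (Ne.symm hu.1) (Ne.symm hu.2)
    have h := hs p hps a ha b hb hap.symm (Ne.symm hbn.1) (Ne.symm hbn.2)
    have := K.mul_mem (K.mul_mem hg h) (K.inv_mem hg)
    rw [conj_threeCycle, threeCycle_apply_left hpr (Ne.symm hu.1),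
      threeCycle_apply_of_ne hap (ne ha hrs) (ne ha hus),
      threeCycle_apply_of_ne hbn.1 (ne hb hrs) (ne hb hus),
      threeCycle_rotate (ne ha hrs).symm (ne hb hrs).symm (Ne.symm hbn.2)] at this
    exact hs.insert_of_threeCycle hrs ha hb (Ne.symm hbn.2) this

/-- A largest set `s` with `Alt(s) ≤ K` is a block for `K`: any `g ∈ K` that maps some point of `s`
into `s` preserves `s`. -/
theorem ContainsAlt.image_eq_of_maximal (hs : ContainsAlt K s) (hs3 : 3 ≤ s.card)
    (hmax : ∀ t, ContainsAlt K t → t.card ≤ s.card) {g : Perm α} (hg : g ∈ K) {p : α}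
    (hp : p ∈ s) (hgp : g p ∈ s) : s.image g = s := by
  have hcard : (s.image g).card = s.card := Finset.card_image_of_injective _ g.injective
  refine Finset.eq_of_subset_of_card_le (fun r hr => ?_) hcard.ge
  by_contra hrs
  have := hmax _ (hs.insert_of_mem_inter (hs.image hg) hs3 (hcard ▸ hs3) hgp
    (Finset.mem_image_of_mem _ hp) hr hrs)
  rw [Finset.card_insert_of_notMem hrs] at this
  omega

/-- The 3-cycles on `s` generate all even permutations supported in `s`. -/
theorem ContainsAlt.mem [Fintype α] (hs : ContainsAlt K s) {g : Perm α}
    (hg : g ∈ alternatingGroup α) (hgs : g.support ⊆ s) : g ∈ K := by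
  induction hn : g.support.card using Nat.strong_induction_on generalizing g with
  | _ n ih =>
  by_cases h1 : g = 1
  · exact h1 ▸ K.one_mem
  obtain ⟨x, hx⟩ : g.support.Nonempty := by
    rwa [Finset.nonempty_iff_ne_empty, Ne, support_eq_empty_iff]
  have hgx : g x ≠ x := mem_support.1 hx
  have h2 : g.support.card ≠ 2 := by
    rw [Ne, card_support_eq_two]
    intro h
    have := mem_alternatingGroup.1 hg
    rw [h.sign_eq] at this
    exact absurd this (by decide)
  have h3 := two_le_card_support_of_ne_one h1
  obtain ⟨z, hz, hzn⟩ : ∃ z ∈ g.support, z ∉ ({x, g x} : Finset α) :=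
    Finset.exists_mem_notMem_of_card_lt_card (Finset.card_le_two.trans_lt (by omega))
  simp only [Finset.mem_insert, Finset.mem_singleton, not_or] at hzn
  -- multiplying by a 3-cycle on the support makes `x` a fixed point
  have hc : threeCycle x (g x) z ∈ K := hs x (hgs hx) _ (hgs (apply_mem_support.2 hx)) z (hgs hz)
    hgx.symm (Ne.symm hzn.1) (Ne.symm hzn.2)
  have hsub : ((threeCycle x (g x) z)⁻¹ * g).support ⊆ g.support.erase x := by
    intro w hw
    rw [mem_support, Perm.mul_apply, Ne, Perm.inv_eq_iff_eq] at hw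
    refine Finset.mem_erase.2 ⟨?_, ?_⟩
    · rintro rfl
      exact hw (threeCycle_apply_left hgx.symm (Ne.symm hzn.1)).symm
    · rw [mem_support]
      intro hgw
      refine hw (hgw.trans (threeCycle_apply_of_ne ?_ ?_ ?_).symm)
      · rintro rfl; exact hgx hgw
      · rintro rfl; exact hgx (g.injective hgw)
      · rintro rfl; exact mem_support.1 hz hgw
  have hlt := Finset.card_lt_card (Finset.erase_ssubset hx)
  have := ih _ (((Finset.card_le_card hsub).trans_lt hlt).trans_eq hn)
    (mul_mem (inv_mem (threeCycle_mem_alternatingGroup hgx.symm (Ne.symm hzn.2))) hg)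
    ((hsub.trans (Finset.erase_subset _ _)).trans hgs) rfl
  rw [← mul_inv_cancel_left (threeCycle x (g x) z) g]
  exact K.mul_mem hc this

end ThreeCycles

/-! ### Subgroups of small index in the alternating group -/

section SmallIndex

open Equiv Equiv.Perm

variable {α : Type*}

/-- Elements of `G` lying in distinct left cosets of `H` bound the index of `H` from below. -/
theorem card_le_index_of_separated {G ι : Type*} [Group G] [Fintype ι] {H : Subgroup G}
    [H.FiniteIndex] (f : ι → G) (hf : ∀ i j, (f i)⁻¹ * f j ∈ H → i = j) :
    Fintype.card ι ≤ H.index := by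
  rw [← Nat.card_eq_fintype_card]
  exact Nat.card_le_card_of_injective (fun i => (f i : G ⧸ H)) fun i j h =>
    hf i j (QuotientGroup.eq.1 h)

theorem choose_le_choose_of_le_half {k r m : ℕ} (hkr : k ≤ r) (hr : r ≤ m / 2) :
    m.choose k ≤ m.choose r := by
  induction r, hkr using Nat.le_induction with
  | base => rfl
  | succ r _ ih => exact (ih (by omega)).trans (Nat.choose_le_succ_of_lt_half_left hr)

/-- A set of at least `n / 2` points has at least `n.choose 2` even permutations. -/
theorem mul_pred_le_factorial {n k : ℕ} (hn : 10 ≤ n) (hk : n ≤ 2 * k) :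
    n * (n - 1) ≤ k.factorial := by
  have h5 : 5 ≤ k := by omega
  refine (Nat.mul_le_mul hk (Nat.sub_le_sub_right hk 1)).trans ?_
  clear hk
  induction k, h5 using Nat.le_induction with
  | base => decide
  | succ k hk ih =>
    rw [Nat.factorial_succ]
    refine le_trans ?_ (Nat.mul_le_mul_left (k + 1) ih)
    obtain ⟨m, rfl⟩ := Nat.exists_eq_add_of_le hk
    have h1 : 2 * (5 + m + 1) - 1 = 2 * m + 11 := by omega
    have h2 : 2 * (5 + m) - 1 = 2 * m + 9 := by omega
    rw [h1, h2]
    nlinarith [Nat.zero_le m, Nat.zero_le (m * m), Nat.zero_le (m * m * m)]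

theorem choose_two_le_pred_choose_three {n : ℕ} (hn : 10 ≤ n) :
    n * (n - 1) / 2 ≤ (n - 1).choose 3 := by
  obtain ⟨m, rfl⟩ := Nat.exists_eq_add_of_le hn
  rw [← Nat.choose_two_right]
  have h1 := Nat.add_one_mul_choose_eq (10 + m - 1) 1
  have h2 : (10 + m - 1).choose 2 * 2 = (10 + m - 1) * (8 + m) := by
    have := Nat.choose_succ_right_eq (10 + m - 1) 1
    rw [Nat.choose_one_right] at this
    convert this using 2
    omega
  have h3 : (10 + m - 1).choose 3 * 3 = (10 + m - 1).choose 2 * (7 + m) := by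
    convert Nat.choose_succ_right_eq (10 + m - 1) 2 using 2
    omega
  have e : 10 + m - 1 = 9 + m := by omega
  have e' : 10 + m - 1 + 1 = 10 + m := by omega
  rw [e', Nat.choose_one_right, e] at h1
  rw [e] at h2 h3 ⊢
  have h4 : (9 + m).choose 2 * 7 ≤ (9 + m).choose 3 * 3 := by
    rw [h3]; exact Nat.mul_le_mul_left _ (by omega)
  nlinarith

section Moving

variable [DecidableEq α] {s t : Finset α}

theorem image_mul (g h : Perm α) (s : Finset α) : s.image (g * h) = (s.image h).image g := by
  rw [Finset.image_image, Perm.coe_mul]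

theorem image_eq_of_inv_mul {g h : Perm α} (hs : s.image ⇑(g⁻¹ * h) = s) :
    s.image h = s.image g := by
  have := congrArg (Finset.image g) hs
  rwa [← image_mul, mul_inv_cancel_left] at this

theorem image_swap_eq {u v : α} (hu : u ∈ s) (hv : v ∈ s) : s.image (swap u v) = s := by
  refine Finset.eq_of_subset_of_card_le ?_
    (Finset.card_image_of_injective _ (Equiv.injective _)).ge
  intro y hy
  obtain ⟨x, hx, rfl⟩ := Finset.mem_image.1 hy
  rw [swap_apply_def]
  split_ifs <;> assumption

variable [Fintype α]

theorem exists_image_eq (h : s.card = t.card) : ∃ g : Perm α, s.image g = t := by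
  let e : {x // x ∈ s} ≃ {x // x ∈ t} := Finset.equivOfCardEq h
  refine ⟨e.extendSubtype, Finset.eq_of_subset_of_card_le ?_ ?_⟩
  · intro y hy
    obtain ⟨x, hx, rfl⟩ := Finset.mem_image.1 hy
    exact e.extendSubtype_mem x hx
  · rw [Finset.card_image_of_injective _ (Equiv.injective _), h]

/-- A permutation carrying `s` to `t` may be made even by a transposition of two points of `s`. -/
theorem exists_even_of_image_eq {g : Perm α} (hg : s.image g = t) {u v : α} (hu : u ∈ s)
    (hv : v ∈ s) (huv : u ≠ v) :
    ∃ h ∈ alternatingGroup α, s.image h = t ∧ ∀ x, x ≠ u → x ≠ v → h x = g x := by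
  rcases Int.units_eq_one_or (sign g) with h | h
  · exact ⟨g, mem_alternatingGroup.2 h, hg, fun _ _ _ => rfl⟩
  · refine ⟨g * swap u v, ?_, ?_, fun x hxu hxv => ?_⟩
    · rw [mem_alternatingGroup, Perm.sign_mul, sign_swap huv, h]; rfl
    · rw [image_mul, image_swap_eq hu hv, hg]
    · rw [Perm.mul_apply, swap_apply_of_ne_of_ne hxu hxv]

theorem exists_even_image_eq (h : s.card = t.card) (hs : 2 ≤ s.card) :
    ∃ g ∈ alternatingGroup α, s.image g = t := by
  obtain ⟨g, hg⟩ := exists_image_eq h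
  obtain ⟨u, hu, v, hv, huv⟩ := Finset.one_lt_card.1 hs
  obtain ⟨k, hk, hk', -⟩ := exists_even_of_image_eq hg hu hv huv
  exact ⟨k, hk, hk'⟩

theorem exists_even_image_eq_fixing (h : s.card = t.card) (hs : 3 ≤ s.card) {p : α} (hps : p ∈ s)
    (hpt : p ∈ t) : ∃ g ∈ alternatingGroup α, s.image g = t ∧ g p = p := by
  obtain ⟨g, hg⟩ := exists_image_eq h
  have hgp : g p ∈ t := hg ▸ Finset.mem_image_of_mem g hps
  obtain ⟨u, hu, v, hv, huv⟩ := Finset.one_lt_card.1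
    (show 1 < (s.erase p).card by rw [Finset.card_erase_of_mem hps]; omega)
  rw [Finset.mem_erase] at hu hv
  obtain ⟨k, hk, hk', hkx⟩ := exists_even_of_image_eq (g := swap (g p) p * g)
    (by rw [image_mul, hg, image_swap_eq hgp hpt]) hu.2 hv.2 huv
  refine ⟨k, hk, hk', ?_⟩
  rw [hkx p hu.1.symm hv.1.symm, Perm.mul_apply, swap_apply_left]

end Moving

variable [Fintype α] [DecidableEq α] {H : Subgroup (alternatingGroup α)}

/-- Bochert's argument: a subgroup of `Aₙ` of small index contains a 3-cycle. -/
theorem exists_threeCycle_mem (hn : 10 ≤ Fintype.card α)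
    (hH : H.index < Fintype.card α * (Fintype.card α - 1) / 2) :
    ∃ a b c : α, a ≠ b ∧ a ≠ c ∧ b ≠ c ∧
      threeCycle a b c ∈ H.map (alternatingGroup α).subtype := by
  -- `K` is `H` as a subgroup of the full symmetric group
  set K := H.map (alternatingGroup α).subtype with hK
  classical
  -- `s` is a largest set such that only the identity of `K` is supported in `s`
  obtain ⟨s, hs, hmax⟩ := Finset.exists_max_image
    (Finset.univ.filter fun s : Finset α => ∀ g ∈ K, g.support ⊆ s → g = 1) Finset.card
    ⟨∅, by
      simp only [Finset.mem_filter, Finset.mem_univ, true_and]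
      intro g _ h
      exact support_eq_empty_iff.1 (Finset.subset_empty.1 h)⟩
  replace hs : ∀ g ∈ K, g.support ⊆ s → g = 1 := (Finset.mem_filter.1 hs).2
  replace hmax : ∀ t : Finset α, s.card < t.card → ∃ g ∈ K, g.support ⊆ t ∧ g ≠ 1 := by
    intro t ht
    by_contra! h
    exact absurd (hmax t (Finset.mem_filter.2 ⟨Finset.mem_univ _, h⟩)) (not_le.2 ht)
  -- the elements of `Alt(s)` lie in distinct cosets, which bounds the size of `s`
  have hsmall : 2 * s.card < Fintype.card α := by
    by_contra! hbig
    have : Nontrivial s := by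
      rw [← Fintype.one_lt_card_iff_nontrivial, Fintype.card_coe]; omega
    have h1 := card_le_index_of_separated (H := H) (alternatingGroup.ofSubtype s) fun i j hij => by
      rw [← map_inv, ← map_mul] at hij
      have h := hs _ (Subgroup.mem_map_of_mem _ hij)
        ((alternatingGroup.mem_range_ofSubtype_iff s _).1 ⟨_, rfl⟩)
      have h' : alternatingGroup.ofSubtype s (i⁻¹ * j) = 1 := Subtype.ext h
      rw [← map_one (alternatingGroup.ofSubtype s)] at h'
      exact inv_mul_eq_one.1 (alternatingGroup.ofSubtype_injective h')
    have h2 := two_mul_card_alternatingGroup (α := s)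
    rw [Fintype.card_perm, Fintype.card_coe] at h2
    have h3 := mul_pred_le_factorial hn hbig
    omega
  obtain ⟨x, hxK, hxs, hx1⟩ := hmax sᶜ (by rw [Finset.card_compl]; omega)
  obtain ⟨p, hp⟩ : x.support.Nonempty := by
    rwa [Finset.nonempty_iff_ne_empty, Ne, support_eq_empty_iff]
  have hps : p ∉ s := Finset.mem_compl.1 (hxs hp)
  obtain ⟨y, hyK, hys, hy1⟩ := hmax (insert p s) (by rw [Finset.card_insert_of_notMem hps]; omega)
  have hyp : y p ≠ p := by
    intro h
    refine hy1 (hs y hyK fun q hq => (Finset.mem_insert.1 (hys hq)).resolve_left ?_)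
    rintro rfl
    exact mem_support.1 hq h
  have hxp : x p ≠ p := mem_support.1 hp
  have hxy : ∀ q, q ≠ p → x q = q ∨ y q = q := by
    intro q hq
    by_contra! h
    exact Finset.mem_compl.1 (hxs (mem_support.2 h.1))
      ((Finset.mem_insert.1 (hys (mem_support.2 h.2))).resolve_left hq)
  refine ⟨y p, p, x p, hyp, fun h => ?_, hxp.symm, ?_⟩
  · rcases hxy (x p) hxp with h1 | h1
    · exact hxp (x.injective h1)
    · rw [← h] at h1; exact hyp (y.injective h1)
  · rw [← commutator_eq_threeCycle hxp hyp hxy]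
    exact K.mul_mem (K.mul_mem (K.mul_mem hxK hyK) (K.inv_mem hxK)) (K.inv_mem hyK)

/-- The translates of a set `s` preserved by `H` correspond to distinct cosets of `H`. -/
theorem choose_le_index_of_image_eq {s : Finset α} (hs2 : 2 ≤ s.card)
    (hs : ∀ g ∈ H.map (alternatingGroup α).subtype, s.image g = s) :
    (Fintype.card α).choose s.card ≤ H.index := by
  have key : ∀ t : Finset.powersetCard s.card (Finset.univ : Finset α),
      ∃ g ∈ alternatingGroup α, s.image g = t.1 := fun t =>
    exists_even_image_eq (Finset.mem_powersetCard.1 t.2).2.symm hs2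
  choose f hf hfs using key
  have := card_le_index_of_separated (H := H) (fun t => ⟨f t, hf t⟩) fun i j hij => by
    have h := image_eq_of_inv_mul (hs _ (Subgroup.mem_map_of_mem _ hij))
    rw [hfs, hfs] at h
    exact Subtype.ext h.symm
  rwa [Fintype.card_coe, Finset.card_powersetCard, Finset.card_univ] at this

/-- If the stabilizer in `H` of a point `p ∈ s` preserves `s`, then the translates of `s` through `p`
can be told apart by the cosets of `H`. The family `u` of even permutations fixing `p`, preserving
`s` and lying in distinct cosets multiplies the resulting lower bound on the index. -/
theorem choose_mul_le_index_of_image_eq {s : Finset α} (hs3 : 3 ≤ s.card) {p : α} (hp : p ∈ s)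
    (hs : ∀ g ∈ H.map (alternatingGroup α).subtype, g p = p → s.image g = s)
    {ι : Type*} [Fintype ι] (u : ι → alternatingGroup α) (hup : ∀ i, (u i).1 p = p)
    (hus : ∀ i, s.image (u i).1 = s) (hu : ∀ i j, (u i)⁻¹ * u j ∈ H → i = j) :
    (Fintype.card α - 1).choose (s.card - 1) * Fintype.card ι ≤ H.index := by
  have key : ∀ t : Finset.powersetCard (s.card - 1) ((Finset.univ : Finset α).erase p),
      ∃ g ∈ alternatingGroup α, s.image g = insert p t.1 ∧ g p = p := fun t => by
    obtain ⟨ht1, ht2⟩ := Finset.mem_powersetCard.1 t.2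
    refine exists_even_image_eq_fixing ?_ hs3 hp (Finset.mem_insert_self _ _)
    rw [Finset.card_insert_of_notMem fun h => Finset.notMem_erase p _ (ht1 h), ht2]
    omega
  choose f hf hfs hfp using key
  have := card_le_index_of_separated (H := H)
    (fun t : Finset.powersetCard (s.card - 1) ((Finset.univ : Finset α).erase p) × ι =>
      ⟨f t.1, hf t.1⟩ * u t.2) fun i j hij => by
    obtain ⟨i, k⟩ := i
    obtain ⟨j, l⟩ := j
    dsimp only at hij
    have h0 : ((f i * (u k).1)⁻¹ * (f j * (u l).1)) ∈ H.map (alternatingGroup α).subtype :=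
      Subgroup.mem_map_of_mem _ hij
    have h := hs _ h0 (by
      rw [Perm.mul_apply, Perm.inv_eq_iff_eq, Perm.mul_apply, Perm.mul_apply, hup, hup, hfp, hfp])
    have h := image_eq_of_inv_mul h
    rw [image_mul, image_mul, hus, hus, hfs, hfs] at h
    have hn : ∀ t : Finset.powersetCard (s.card - 1) ((Finset.univ : Finset α).erase p),
        p ∉ t.1 := fun t h => Finset.notMem_erase p _ ((Finset.mem_powersetCard.1 t.2).1 h)
    have hij' : j = i := by
      apply Subtype.ext
      rw [← Finset.erase_insert (hn i), ← Finset.erase_insert (hn j), h]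
    subst hij'
    rw [mul_inv_rev, mul_assoc, inv_mul_cancel_left] at hij
    rw [hu _ _ hij]
  rwa [Fintype.card_prod, Fintype.card_coe, Finset.card_powersetCard,
    Finset.card_erase_of_mem (Finset.mem_univ p), Finset.card_univ] at this

/-- For `n ≥ 10`, the subgroups of `Aₙ` of index below `n.choose 2` are `Aₙ` and the point
stabilizers. -/
theorem eq_top_or_eq_stabilizer_of_index_lt (hn : 10 ≤ Fintype.card α)
    (hH : H.index < Fintype.card α * (Fintype.card α - 1) / 2) :
    H = ⊤ ∨ ∃ a : α, H = MulAction.stabilizer (alternatingGroup α) a := by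
  -- `K` is `H` as a subgroup of the full symmetric group
  set K := H.map (alternatingGroup α).subtype with hK
  classical
  obtain ⟨a, b, c, hab, hac, hbc, habc⟩ := exists_threeCycle_mem hn hH
  obtain ⟨s, hs, hmax⟩ := Finset.exists_max_image
    (Finset.univ.filter fun s : Finset α => ContainsAlt K s) Finset.card
    ⟨_, Finset.mem_filter.2 ⟨Finset.mem_univ _, containsAlt_triple hab hac hbc habc⟩⟩
  replace hs : ContainsAlt K s := (Finset.mem_filter.1 hs).2
  replace hmax : ∀ t, ContainsAlt K t → t.card ≤ s.card := fun t ht =>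
    hmax t (Finset.mem_filter.2 ⟨Finset.mem_univ _, ht⟩)
  have hs3 : 3 ≤ s.card := by
    rw [← Finset.card_eq_three.2 ⟨a, b, c, hab, hac, hbc, rfl⟩]
    exact hmax _ (containsAlt_triple hab hac hbc habc)
  have hsn : s.card ≤ Fintype.card α := Finset.card_le_univ s
  have hblock : ∀ g ∈ K, ∀ p ∈ s, g p ∈ s → s.image g = s := fun g hg p hp hgp =>
    hs.image_eq_of_maximal hs3 hmax hg hp hgp
  have mem_of_map : ∀ g : alternatingGroup α, g.1 ∈ K → g ∈ H := by
    rintro g ⟨k, hk, hkg⟩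
    exact Subtype.ext hkg ▸ hk
  by_cases hlarge : Fintype.card α ≤ s.card + 1
  · -- `K` contains the even permutations fixing a point `x`
    have : Nonempty α := ⟨a⟩
    obtain ⟨x, hx⟩ : ∃ x, Finset.univ.erase x ⊆ s := by
      have h1 : sᶜ.card ≤ 1 := by rw [Finset.card_compl]; omega
      rcases Finset.card_le_one_iff_subset_singleton.1 h1 with ⟨x, hx⟩
      exact ⟨x, fun y hy => by
        by_contra h
        exact (Finset.mem_erase.1 hy).1 (Finset.mem_singleton.1 (hx (Finset.mem_compl.2 h)))⟩
    have hle : MulAction.stabilizer (alternatingGroup α) x ≤ H := by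
      intro g hg
      refine mem_of_map g (hs.mem g.2 fun y hy => hx (Finset.mem_erase.2 ⟨?_, Finset.mem_univ _⟩))
      rintro rfl
      exact mem_support.1 hy hg
    have hco := alternatingGroup.isCoatom_stabilizer_singleton (α := α)
      (by rw [Nat.card_eq_fintype_card]; omega) (Set.singleton_nonempty x)
      Set.subsingleton_singleton
    rw [MulAction.stabilizer_singleton] at hco
    rcases hco.le_iff.1 hle with h | h
    · exact Or.inl h
    · exact Or.inr ⟨x, h⟩
  exfalso
  rw [← Nat.choose_two_right] at hH
  by_cases hhalf : Fintype.card α < 2 * s.card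
  · -- two translates of `s` always meet, so `K` preserves `s`
    have := choose_le_index_of_image_eq (H := H) (s := s) (by omega) fun g hg => by
      obtain ⟨q, hq⟩ : (s.image g ∩ s).Nonempty := by
        rw [← Finset.card_pos]
        have h1 := Finset.card_union_add_card_inter (s.image g) s
        rw [Finset.card_image_of_injective _ g.injective] at h1
        have h2 := Finset.card_le_univ (s.image g ∪ s)
        omega
      obtain ⟨hq1, hq2⟩ := Finset.mem_inter.1 hq
      obtain ⟨r, hr, rfl⟩ := Finset.mem_image.1 hq1
      exact hblock g hg r hr hq2
    rw [← Nat.choose_symm hsn] at this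
    have := choose_le_choose_of_le_half (k := 2) (r := Fintype.card α - s.card)
      (m := Fintype.card α) (by omega) (by omega)
    omega
  · obtain ⟨p, hp⟩ : s.Nonempty := Finset.card_pos.1 (by omega)
    have hfix : ∀ g ∈ K, g p = p → s.image g = s := fun g hg h => hblock g hg p hp (h.symm ▸ hp)
    by_cases h4 : 4 ≤ s.card
    · have h1 := choose_mul_le_index_of_image_eq hs3 hp hfix (ι := Unit) (fun _ => 1)
        (fun _ => rfl) (fun _ => by simp) fun _ _ _ => rfl
      have h2 := choose_le_choose_of_le_half (k := 3) (r := s.card - 1)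
        (m := Fintype.card α - 1) (by omega) (by omega)
      have h3 := choose_two_le_pred_choose_three hn
      rw [← Nat.choose_two_right] at h3
      rw [Fintype.card_unit, mul_one] at h1
      omega
    · -- an even permutation of the complement of `s` outside `K` doubles the estimate
      obtain ⟨v, hvH, hvs⟩ : ∃ v : alternatingGroup α, v ∉ H ∧ ∀ q ∈ s, v.1 q = q := by
        by_contra! h
        have : ContainsAlt K sᶜ := by
          intro a ha b hb c hc hab hac hbc
          rw [Finset.mem_compl] at ha hb hc
          by_contra hK
          obtain ⟨q, hq, hne⟩ := h ⟨_, threeCycle_mem_alternatingGroup hab hbc⟩ fun hmem =>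
            hK (Subgroup.mem_map_of_mem _ hmem)
          exact hne (threeCycle_apply_of_ne (fun h => ha (h ▸ hq)) (fun h => hb (h ▸ hq))
            fun h => hc (h ▸ hq))
        have := hmax _ this
        rw [Finset.card_compl] at this
        omega
      have h1 := choose_mul_le_index_of_image_eq hs3 hp hfix (ι := Bool)
        (fun i => if i then v else 1)
        (fun i => by cases i <;> simp [hvs p hp])
        (fun i => by
          cases i
          · simp
          · simpa using Finset.image_congr (g := id) (s := s) fun q hq => hvs q hq)
        (fun i j => by cases i <;> cases j <;> simp [hvH])
      have h3 : s.card - 1 = 2 := by omega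
      have h4 : (Fintype.card α - 1).choose 2 * 2 = _ :=
        Nat.choose_succ_right_eq (Fintype.card α - 1) 1
      rw [Nat.choose_two_right] at hH
      rw [h3, Fintype.card_bool] at h1
      rw [Nat.choose_one_right] at h4
      have h6 : Fintype.card α * (Fintype.card α - 1) / 2 ≤
          (Fintype.card α - 1) * (Fintype.card α - 1 - 1) := by
        refine Nat.div_le_of_le_mul ?_
        rw [mul_comm (Fintype.card α), mul_left_comm]
        exact Nat.mul_le_mul_left _ (by omega)
      omega

end SmallIndex

/-! ### Affine actions permute facets -/

section Facets

variable {G E : Type*} [Group G] [AddCommGroup E] [Module ℝ E] [MulAction G E]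

theorem finrank_vectorSpan_smul (hG : IsAffineAction G E) (g : G) (s : Set E) :
    Module.finrank ℝ (vectorSpan ℝ (g • s)) = Module.finrank ℝ (vectorSpan ℝ s) := by
  obtain ⟨A, hA⟩ := hG g
  have hinj : Function.Injective A := fun x y h => by
    rw [← hA, ← hA] at h
    exact smul_left_cancel g h
  have himg : g • s = A '' s := Set.image_congr fun x _ => hA x
  rw [himg, ← AffineMap.map_vectorSpan]
  exact (Submodule.equivMapOfInjective _ (A.linear_injective_iff.2 hinj) _).finrank_eq.symm

variable [TopologicalSpace E] [IsTopologicalAddGroup E] [ContinuousSMul ℝ E] [T2Space E]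
  [FiniteDimensional ℝ E]

theorem isExposed_smul (hG : IsAffineAction G E) {Q F : Set E} (hF : IsExposed ℝ Q F) (g : G) :
    IsExposed ℝ (g • Q) (g • F) := by
  intro hne
  obtain ⟨l, hl⟩ := hF (Set.smul_set_nonempty.1 hne)
  obtain ⟨A, hA⟩ := hG g⁻¹
  refine ⟨l.comp (LinearMap.toContinuousLinearMap A.linear), ?_⟩
  -- the transported functional differs from `l ∘ A` by a constant
  have hcomp : ∀ x, l (g⁻¹ • x) = l (A.linear x) + l (A 0) := fun x => by
    rw [hA, A.decomp', ← map_add]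
    simp
  ext x
  rw [Set.mem_smul_set_iff_inv_smul_mem, hl]
  simp only [Set.mem_ofPred_eq, Set.mem_smul_set_iff_inv_smul_mem, ContinuousLinearMap.comp_apply,
    LinearMap.coe_toContinuousLinearMap']
  refine and_congr_right fun _ => ⟨fun h y hy => ?_, fun h y hy => ?_⟩
  · have := h _ hy
    rw [hcomp, hcomp] at this
    linarith
  · have := h (g • y) (by rwa [inv_smul_smul])
    rw [← inv_smul_smul g y, hcomp, hcomp]
    linarith

theorem smul_mem_facets (hG : IsAffineAction G E) {Q F : Set E} (hQ : ∀ g : G, g • Q = Q)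
    (hF : F ∈ facets Q) (g : G) : g • F ∈ facets Q := by
  obtain ⟨h1, h2, h3⟩ := hF
  refine ⟨h1.smul_set, ?_, ?_⟩
  · have := isExposed_smul hG h2 g
    rwa [hQ] at this
  · rw [finrank_vectorSpan_smul hG, h3]

end Facets

/-! ### Orbits of facets -/

/-- Transitive actions with equal point stabilizers are isomorphic. -/
theorem isoActions_orbit_of_stabilizer_eq {G X Y : Type*} [Group G] [MulAction G X]
    [MulAction G Y] [MulAction.IsPretransitive G Y] {x : X} {y : Y}
    (h : MulAction.stabilizer G x = MulAction.stabilizer G y) :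
    IsoActions G (MulAction.orbit G x) Y := by
  have hiff : ∀ g k : G, g • x = k • x ↔ g • y = k • y := fun g k => by
    rw [← inv_smul_eq_iff, ← mul_smul, ← inv_smul_eq_iff (g := k), ← mul_smul,
      ← MulAction.mem_stabilizer_iff, h, MulAction.mem_stabilizer_iff]
  choose f hf using fun z : MulAction.orbit G x => z.2
  dsimp only at hf
  refine ⟨⟨fun z => f z • y, fun k z => ?_⟩, fun z w hzw => ?_, fun w => ?_⟩
  · rw [id, ← mul_smul, ← hiff, hf, mul_smul, hf, MulAction.orbit.coe_smul]
  · exact Subtype.ext (by rw [← hf z, ← hf w, hiff]; exact hzw)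
  · obtain ⟨k, rfl⟩ := MulAction.exists_smul_eq G y w
    exact ⟨⟨k • x, k, rfl⟩, (hiff _ _).1 (hf _)⟩

theorem encard_eq_of_isoActions {G X Y : Type*} [Group G] [MulAction G X] [MulAction G Y] {x : X}
    (h : IsoActions G (MulAction.orbit G x) Y) : (MulAction.orbit G x).encard = ENat.card Y := by
  obtain ⟨f, hf⟩ := h
  exact ENat.card_congr (Equiv.ofBijective f hf)

theorem mainTheorem3 (n m d N : ℕ) (hn : 10 ≤ n)
    [MulAction (alternatingGroup (Fin n)) (EuclideanSpace ℝ (Fin m))]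
    [MulAction (alternatingGroup (Fin n)) (EuclideanSpace ℝ (Fin d))]
    (P : Set (EuclideanSpace ℝ (Fin m))) (Q : Set (EuclideanSpace ℝ (Fin d)))
    (p : EuclideanSpace ℝ (Fin d) →ₗ[ℝ] EuclideanSpace ℝ (Fin m))
    (hP : IsGPolytope (alternatingGroup (Fin n)) P)
    (hQ : IsSymmetricExtension (alternatingGroup (Fin n)) Q p P)
    (hcard : (facets Q).encard = N) (hN : N < n * (n - 1) / 2) :
    -- each orbit of a facet is isomorphic to `[n]` or to the one-point action
    (∀ j ∈ facets Q,
      IsoActions (alternatingGroup (Fin n))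
        (MulAction.orbit (alternatingGroup (Fin n)) j) (Fin n) ∨
      IsoActions (alternatingGroup (Fin n))
        (MulAction.orbit (alternatingGroup (Fin n)) j) PUnit.{1}) ∧
    -- the orbits of the facets partition the set of facets into sets of sizes `n` and `1`
    ((MulAction.orbit (alternatingGroup (Fin n)) '' facets Q).PairwiseDisjoint id ∧
      ⋃₀ (MulAction.orbit (alternatingGroup (Fin n)) '' facets Q) = facets Q ∧
      ∀ O ∈ MulAction.orbit (alternatingGroup (Fin n)) '' facets Q,
        O.encard = n ∨ O.encard = 1) := by
  have horbit : ∀ j ∈ facets Q, MulAction.orbit (alternatingGroup (Fin n)) j ⊆ facets Q := by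
    rintro j hj _ ⟨g, rfl⟩
    exact smul_mem_facets hQ.isGPolytope.isAffineAction hQ.isGPolytope.smul_eq hj g
  have hfin : (facets Q).Finite := Set.finite_of_encard_eq_coe hcard
  have hncard : (facets Q).ncard = N := by rw [Set.ncard, hcard, ENat.toNat_natCast]
  have hiso : ∀ j ∈ facets Q,
      IsoActions (alternatingGroup (Fin n))
        (MulAction.orbit (alternatingGroup (Fin n)) j) (Fin n) ∨
      IsoActions (alternatingGroup (Fin n))
        (MulAction.orbit (alternatingGroup (Fin n)) j) PUnit.{1} := by
    intro j hj
    have hindex : (MulAction.stabilizer (alternatingGroup (Fin n)) j).index < n * (n - 1) / 2 := by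
      rw [MulAction.index_stabilizer]
      exact ((Set.ncard_le_ncard (horbit j hj) hfin).trans_eq hncard).trans_lt hN
    rcases eq_top_or_eq_stabilizer_of_index_lt (α := Fin n) (by rwa [Fintype.card_fin])
      (by rwa [Fintype.card_fin]) with h | ⟨a, h⟩
    · refine Or.inr (isoActions_orbit_of_stabilizer_eq (y := PUnit.unit) ?_)
      rw [h, eq_comm, Subgroup.eq_top_iff']
      exact fun _ => rfl
    · have := alternatingGroup.isPreprimitive_of_three_le_card (Fin n)
        (by rw [Nat.card_eq_fintype_card, Fintype.card_fin]; omega)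
      exact Or.inl (isoActions_orbit_of_stabilizer_eq h)
  refine ⟨hiso, ?_, ?_, ?_⟩
  · rintro _ ⟨j, -, rfl⟩ _ ⟨k, -, rfl⟩ hjk
    exact (MulAction.orbit.eq_or_disjoint j k).resolve_left hjk
  · refine subset_antisymm (Set.sUnion_subset ?_) fun j hj =>
      ⟨_, ⟨j, hj, rfl⟩, MulAction.mem_orbit_self j⟩
    rintro _ ⟨j, hj, rfl⟩
    exact horbit j hj
  · rintro _ ⟨j, hj, rfl⟩
    rcases hiso j hj with h | h
    · left; simpa using encard_eq_of_isoActions h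
    · right; simpa using encard_eq_of_isoActions h
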